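/- Let $a < b < -1$ be real numbers and let $k$ be a positive integer. All functions are real-valued. Then the following hold: (a) the convex hull of the set of functions $\{x^{kn} : n \ge 0\}$ is dense in $C(a,-1)$, the space of continuous real-valued functions on the open interval $(a,-1)$ with the topology of uniform convergence on compact subsets of $(a,-1)$, if and only if $k$ is odd; (b) the convex hull of the set of functions $\{x^{kn} : n \ge 0\}$ is dense in $C[a,b]$, the space of continuous real-valued functions on the closed interval $[a,b]$ with the topology of uniform convergence on $[a,b]$, if and only if $k$ is odd. -/

import Mathlib

/-- The monomial `x ↦ x ^ m`, as an element of the space `C(S, ℝ)` of continuous real-valued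
functions on a set `S` of real numbers. -/
def monomialOn (S : Set ℝ) (m : ℕ) : C(S, ℝ) where
  toFun x := (x : ℝ) ^ m
  continuous_toFun := by fun_prop

/-- The convex hull, in `C(S, ℝ)`, of the monomials `x ^ (k * n)` with `n ≥ 0`. -/
def convexPowers (S : Set ℝ) (k : ℕ) : Set C(S, ℝ) :=
  convexHull ℝ (Set.range fun n : ℕ => monomialOn S (k * n))

open Filter Topology
open scoped NNReal Pointwise

/-! ### Closed cones of nonnegative-coefficient polynomials -/

section Cone

variable {Z : Type*} [NormedCommRing Z] [NormedAlgebra ℝ Z]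

/-! For even `k` the hull stays in the closed half-space of functions nonnegative at a point. For
odd `k`, restrict to a compact set and put `τ = x ^ k < -1`. Work in `C(X, ℝ) × ℝ` with `T = (τ,
1)`: the second coordinate of a nonnegative combination of powers of `T` is its coefficient sum. If
the closed cone `E` of such combinations contains every `(f, 0)`, then `f - 1` is a limit of
combinations of mass below one, and topping these up with the constant `1` gives convex combinations
tending to `f`. The crux is `neg_one_mem_closedPowerCone`: `(-1, 0) ∈ E`. It makes the slice `{g |
(g, 0) ∈ E}` a closed real algebra, and Stone–Weierstrass applies. -/

theorem Subalgebra.real_smul_mem (E : Subalgebra ℝ≥0 Z) {c : ℝ} (hc : 0 ≤ c) {z : Z}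
    (hz : z ∈ E) : c • z ∈ E :=
  E.smul_mem hz (⟨c, hc⟩ : ℝ≥0)

theorem Subalgebra.exists_mul_one_sub_eq_one [CompleteSpace Z] (E : Subalgebra ℝ≥0 Z)
    (hE : IsClosed (E : Set Z)) {z : Z} (hz : z ∈ E) (h : ‖z‖ < 1) :
    ∃ w ∈ E, w * (1 - z) = 1 := by
  have hs := (summable_geometric_of_norm_lt_one h).hasSum
  refine ⟨∑' i, z ^ i, ?_, geom_series_mul_neg z h⟩
  exact hE.mem_of_tendsto hs (Eventually.of_forall fun s => E.sum_mem fun i _ => E.pow_mem hz i)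

/-- The resolvent `(1 - r T)⁻¹` can be continued from `r` to `r + δ` inside a closed cone. -/
theorem Subalgebra.exists_resolvent_add [CompleteSpace Z] (E : Subalgebra ℝ≥0 Z)
    (hE : IsClosed (E : Set Z)) {T V : Z} (hT : T ∈ E) (hV : V ∈ E) {r δ : ℝ} (hδ : 0 ≤ δ)
    (hVT : V * (1 - r • T) = 1) (h : ‖δ • (T * V)‖ < 1) :
    ∃ W ∈ E, W * (1 - (r + δ) • T) = 1 := by
  obtain ⟨w, hw, hw1⟩ := E.exists_mul_one_sub_eq_one hE
    (E.real_smul_mem hδ (E.mul_mem hT hV)) h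
  refine ⟨V * w, E.mul_mem hV hw, ?_⟩
  have : (1 - (r + δ) • T) = (1 - r • T) * (1 - δ • (T * V)) := by
    simp only [Algebra.smul_def, map_add] at *
    linear_combination (algebraMap ℝ Z δ * T) * hVT
  rw [this]
  linear_combination hVT * (w * (1 - δ • (T * V))) + hw1

/-- `V = 1 + S + ... + S ^ n * V`, so in the order defined by `E` one resolvent dominates all powers
of `S`. -/
theorem Subalgebra.resolvent_sub_pow_mem (E : Subalgebra ℝ≥0 Z) {S V : Z} (hS : S ∈ E)
    (hV : V ∈ E) (hVS : V * (1 - S) = 1) (n : ℕ) : V - S ^ n ∈ E := by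
  induction n with
  | zero =>
    have : V - S ^ 0 = S * V := by linear_combination hVS
    rw [this]
    exact E.mul_mem hS hV
  | succ n ih =>
    have : V - S ^ (n + 1) = 1 + S * (V - S ^ n) := by linear_combination hVS
    rw [this]
    exact E.add_mem E.one_mem (E.mul_mem hS ih)

theorem Subalgebra.pow_mul_one_sub_pow_mem (E : Subalgebra ℝ≥0 Z) {Q V : Z} {δ : ℝ}
    (hδ : 0 ≤ δ) (hQ : Q ∈ E) (hV : V ∈ E) (h : ∀ j, δ ^ j • V - Q ^ j ∈ E) (n : ℕ) :
    ∀ j, Q ^ j * (1 - Q) ^ n + (δ ^ j * (1 + δ) ^ n) • V ∈ E ∧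
      -(Q ^ j * (1 - Q) ^ n) + (δ ^ j * (1 + δ) ^ n) • V ∈ E := by
  induction n with
  | zero =>
    intro j
    constructor
    · simpa using E.add_mem (E.pow_mem hQ j) (E.real_smul_mem (pow_nonneg hδ j) hV)
    · simpa [add_comm, sub_eq_add_neg] using h j
  | succ n ih =>
    intro j
    constructor
    · have := E.add_mem (ih j).1 (ih (j + 1)).2
      convert this using 1
      simp only [Algebra.smul_def, map_add, map_mul, map_pow, map_one]
      ring
    · have := E.add_mem (ih j).2 (ih (j + 1)).1
      convert this using 1
      simp only [Algebra.smul_def, map_add, map_mul, map_pow, map_one]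
      ring

/-- Splitting off the constant term of `(1 - Q) ^ n` leaves a multiple of `V` that vanishes as `n *
δ → 0`. -/
theorem Subalgebra.one_sub_pow_sub_one_mem (E : Subalgebra ℝ≥0 Z) {Q V : Z} {δ : ℝ}
    (hδ : 0 ≤ δ) (hQ : Q ∈ E) (hV : V ∈ E) (h : ∀ j, δ ^ j • V - Q ^ j ∈ E) (n : ℕ) :
    (1 - Q) ^ n - 1 + ((1 + δ) ^ n - 1) • V ∈ E := by
  induction n with
  | zero => simp
  | succ n ih =>
    have := E.add_mem ih (E.pow_mul_one_sub_pow_mem hδ hQ hV h n 1).2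
    convert this using 1
    simp only [Algebra.smul_def, map_sub, map_add, map_mul, map_pow, map_one]
    ring

/-- The set of values at `T` of the polynomials with nonnegative coefficients. -/
noncomputable def powerCone (T : Z) : Subalgebra ℝ≥0 Z :=
  Algebra.adjoin ℝ≥0 {T}

/-- The closure of `powerCone T`. -/
noncomputable def closedPowerCone (T : Z) : Subalgebra ℝ≥0 Z :=
  (powerCone T).topologicalClosure

theorem isClosed_closedPowerCone (T : Z) : IsClosed (closedPowerCone T : Set Z) :=
  Subalgebra.isClosed_topologicalClosure _

theorem self_mem_closedPowerCone (T : Z) : T ∈ closedPowerCone T :=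
  Subalgebra.le_topologicalClosure _ (Algebra.subset_adjoin rfl)

theorem powerCone_induction {T : Z} {p : Z → Prop} (pow : ∀ n : ℕ, p (T ^ n)) (zero : p 0)
    (add : ∀ x y, p x → p y → p (x + y)) (smul : ∀ (c : ℝ) x, 0 ≤ c → p x → p (c • x))
    {z : Z} (hz : z ∈ powerCone T) : p z := by
  rw [powerCone, ← Subalgebra.mem_toSubmodule, Algebra.adjoin_eq_span] at hz
  induction hz using Submodule.span_induction with
  | mem z hz =>
    obtain ⟨n, rfl⟩ := Submonoid.mem_closure_singleton.1 hz
    exact pow n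
  | zero => exact zero
  | add x y _ _ hx hy => exact add x y hx hy
  | smul c x _ hx => exact smul c x c.2 hx

end Cone

/-- If `0 < x < y`, some sequence of exponents `N m` has `N m * x ^ m → 0` and
`N m * y ^ m → ∞`. -/
theorem exists_tendsto_mul_pow {x y : ℝ} (hx : 0 < x) (hxy : x < y) (hx1 : x < 1) :
    ∃ N : ℕ → ℕ, Tendsto (fun m => N m * x ^ m) atTop (𝓝 0) ∧
      Tendsto (fun m => N m * y ^ m) atTop atTop := by
  have hy : 0 < y := hx.trans hxy
  obtain ⟨γ, h1, h2⟩ := exists_between (inv_strictAnti₀ hx hxy)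
  have hγ : 0 < γ := (inv_pos.2 hy).trans h1
  refine ⟨fun m => ⌈γ ^ m⌉₊, ?_, ?_⟩
  · have hlim : Tendsto (fun m : ℕ => (γ * x) ^ m + x ^ m) atTop (𝓝 0) := by
      simpa using (tendsto_pow_atTop_nhds_zero_of_lt_one (by positivity)
        (by simpa [hx.ne'] using mul_lt_mul_of_pos_right h2 hx)).add
        (tendsto_pow_atTop_nhds_zero_of_lt_one hx.le hx1)
    refine squeeze_zero (fun m => by positivity) (fun m => ?_) hlim
    have := (Nat.ceil_lt_add_one (pow_nonneg hγ.le m)).le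
    calc (⌈γ ^ m⌉₊ : ℝ) * x ^ m ≤ (γ ^ m + 1) * x ^ m := by gcongr
      _ = _ := by ring
  · have h3 : 1 < γ * y := by
      have := mul_lt_mul_of_pos_right h1 hy
      rwa [inv_mul_cancel₀ hy.ne'] at this
    refine tendsto_atTop_mono (fun m => ?_) (tendsto_pow_atTop_atTop_of_one_lt h3)
    rw [mul_pow]
    gcongr
    exact Nat.le_ceil _

theorem tendsto_one_add_pow_sub_one {N : ℕ → ℕ} {d : ℕ → ℝ} (hd : ∀ m, 0 ≤ d m)
    (h : Tendsto (fun m => N m * d m) atTop (𝓝 0)) :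
    Tendsto (fun m => (1 + d m) ^ N m - 1) atTop (𝓝 0) := by
  have hlim : Tendsto (fun m => Real.exp (N m * d m) - 1) atTop (𝓝 0) := by
    simpa using ((Real.continuous_exp.tendsto 0).comp h).sub_const 1
  refine squeeze_zero (fun m => ?_) (fun m => ?_) hlim
  · linarith [one_le_pow₀ (n := N m) (by linarith [hd m] : 1 ≤ 1 + d m)]
  · rw [Real.exp_nat_mul]
    gcongr
    · linarith [hd m]
    · linarith [Real.add_one_le_exp (d m)]

/-! ### Density on a compact space -/

section Compact

variable {X : Type*} [TopologicalSpace X] [CompactSpace X]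

/-- The Neumann series may diverge at `r`, but `1 - s * τ ≥ 1` and `1 - s > 0` for `0 ≤ s ≤ r`, so
the resolvent continues from `0` to `r` in small steps. -/
theorem exists_resolvent_mem_closedPowerCone (τ : C(X, ℝ)) (hτ : ∀ x, τ x ≤ 0) {r : ℝ}
    (hr : 0 ≤ r) (hr1 : r < 1) :
    ∃ V ∈ closedPowerCone (τ, (1 : ℝ)), V * (1 - r • (τ, (1 : ℝ))) = 1 := by
  set c := ‖τ‖ + 1
  have hc : 0 < c := by positivity
  -- As `0 < V.1 ≤ 1`, the bound `c` controls `τ * V.1` at every stage, so a uniform step `r / M`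
  -- suffices.
  obtain ⟨M, hM⟩ := exists_nat_gt (r * c)
  have hM0 : (0 : ℝ) < M := (by positivity : 0 ≤ r * c).trans_lt hM
  have key : ∀ i : ℕ, i ≤ M → ∃ V ∈ closedPowerCone (τ, (1 : ℝ)),
      V * (1 - (i * (r / M)) • (τ, (1 : ℝ))) = 1 := by
    intro i
    induction i with
    | zero => exact fun _ => ⟨1, one_mem _, by simp⟩
    | succ i ih =>
      intro hi
      obtain ⟨V, hV, hVT⟩ := ih (by omega)
      have hi' : ((i : ℝ) + 1) * (r / M) ≤ r := by
        have : ((i : ℝ) + 1) ≤ M := by exact_mod_cast hi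
        calc _ ≤ M * (r / M) := by gcongr
          _ = r := by field_simp
      have hs : 0 ≤ (i : ℝ) * (r / M) := by positivity
      have hδ : 0 ≤ r / M := by positivity
      have hδc : r / M * c < 1 := by
        rw [div_mul_eq_mul_div, div_lt_one hM0]; exact hM
      obtain ⟨W, hW, hWT⟩ := (closedPowerCone (τ, (1 : ℝ))).exists_resolvent_add
        (isClosed_closedPowerCone _) (self_mem_closedPowerCone _) hV hδ hVT <| by
        have h1 : ∀ x, V.1 x * (1 - (i * (r / M)) * τ x) = 1 := fun x => by
          simpa using congrArg (fun z : C(X, ℝ) × ℝ => z.1 x) hVT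
        have h2 : V.2 * (1 - i * (r / M)) = 1 := by
          simpa using congrArg (fun z : C(X, ℝ) × ℝ => z.2) hVT
        set s := (i : ℝ) * (r / M)
        rw [Prod.norm_def]
        refine max_lt ?_ ?_
        · refine (ContinuousMap.norm_lt_iff _ one_pos).2 fun x => ?_
          have hx := h1 x
          have hp : 1 ≤ 1 - s * τ x := by nlinarith [hτ x]
          have hV0 : 0 < V.1 x := by
            by_contra! h
            nlinarith
          have hV1 : V.1 x ≤ 1 := by nlinarith
          have hτc : |τ x| ≤ c := by
            have := τ.norm_coe_le_norm x
            rw [Real.norm_eq_abs] at this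
            simp only [c]; linarith
          simp only [Prod.smul_fst, Prod.fst_mul, ContinuousMap.smul_apply,
            ContinuousMap.mul_apply, smul_eq_mul, Real.norm_eq_abs, abs_mul, abs_of_nonneg hδ,
            abs_of_pos hV0]
          calc r / M * (|τ x| * V.1 x) ≤ r / M * (c * 1) := by gcongr
            _ < 1 := by simpa using hδc
        · have hp : 0 < 1 - s := by linarith
          have hV0 : 0 < V.2 := by
            by_contra! h
            nlinarith
          simp only [Prod.smul_snd, Prod.snd_mul, smul_eq_mul, one_mul, Real.norm_eq_abs, abs_mul,
            abs_of_nonneg hδ, abs_of_pos hV0]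
          calc r / M * V.2 < (1 - s) * V.2 := by
                gcongr
                linarith
            _ = 1 := by linarith
      exact ⟨W, hW, by rwa [Nat.cast_succ, add_one_mul]⟩
  obtain ⟨V, hV, hVT⟩ := key M le_rfl
  refine ⟨V, hV, ?_⟩
  rwa [mul_div_cancel₀ _ hM0.ne'] at hVT

theorem neg_one_mem_closedPowerCone (τ : C(X, ℝ)) {β : ℝ} (hβ : 1 < β) (hτ : ∀ x, τ x ≤ -β) :
    ((-1, 0) : C(X, ℝ) × ℝ) ∈ closedPowerCone (τ, (1 : ℝ)) := by
  set E := closedPowerCone (τ, (1 : ℝ))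
  set T : C(X, ℝ) × ℝ := (τ, 1)
  have hT : T ∈ E := self_mem_closedPowerCone _
  obtain ⟨ρ, hρ, hρβ⟩ := exists_between hβ
  have hρ0 : 0 < ρ := by linarith
  obtain ⟨V, hV, hVT⟩ := exists_resolvent_mem_closedPowerCone τ (fun x => by linarith [hτ x])
    (inv_nonneg.2 hρ0.le) (inv_lt_one_of_one_lt₀ hρ)
  set c := ‖τ‖ + β
  have hcβ : β ≤ c := by simp [c]
  have hc : 0 < c := by linarith
  have hpow := E.resolvent_sub_pow_mem (E.real_smul_mem (inv_nonneg.2 hρ0.le) hT) hV hVT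
  -- Since `ρ < β ≤ |τ|`, these exponents send `(1 - Q m) ^ N m` to `(0, 1)` while the multiple of
  -- `V` dies; subtracting `(1, 1)` leaves `(-1, 0)`. Even powers make `Q m` nonnegative.
  obtain ⟨N, hN0, hN⟩ := exists_tendsto_mul_pow (x := (ρ / c) ^ 2) (y := (β / c) ^ 2)
    (by positivity) (by gcongr)
    (pow_lt_one₀ (by positivity) ((div_lt_one hc).2 (by linarith)) two_ne_zero)
  let Q : ℕ → C(X, ℝ) × ℝ := fun m => (c⁻¹ • T) ^ (2 * m)
  let δ : ℕ → ℝ := fun m => ((ρ / c) ^ 2) ^ m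
  have hδ : ∀ m, 0 ≤ δ m := fun m => by positivity
  have hQ : ∀ m, Q m ∈ E := fun m =>
    E.pow_mem (E.real_smul_mem (inv_nonneg.2 hc.le) hT) _
  have hQV : ∀ m j, δ m ^ j • V - Q m ^ j ∈ E := fun m j => by
    have := E.real_smul_mem (pow_nonneg (hδ m) j) (hpow (2 * m * j))
    convert this using 1
    rw [smul_sub]
    congr 1
    simp only [Q, δ, smul_pow, smul_smul, ← pow_mul]
    congr 1
    rw [div_pow, inv_pow, inv_pow]
    field_simp
  have hmem := fun m => E.one_sub_pow_sub_one_mem (hδ m) (hQ m) hV (hQV m) (N m)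
  have hlimδ : Tendsto (fun m => (1 + δ m) ^ N m - 1) atTop (𝓝 0) :=
    tendsto_one_add_pow_sub_one hδ hN0
  have hlimV : Tendsto (fun m => ((1 + δ m) ^ N m - 1) • V) atTop (𝓝 0) := by
    simpa using hlimδ.smul_const V
  have hQ1 : ∀ m x, (Q m).1 x = ((τ x / c) ^ 2) ^ m := fun m x => by
    simp [Q, T, pow_mul, div_eq_inv_mul]
  have hQ2 : ∀ m, (Q m).2 = ((1 / c) ^ 2) ^ m := fun m => by
    simp [Q, T, pow_mul]
  have hlim1 : Tendsto (fun m => (1 - (Q m).1) ^ N m) atTop (𝓝 0) := by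
    have hexp : Tendsto (fun m => Real.exp (-(N m * ((β / c) ^ 2) ^ m))) atTop (𝓝 0) :=
      Real.tendsto_exp_neg_atTop_nhds_zero.comp hN
    refine squeeze_zero_norm (fun m => ?_) hexp
    refine (ContinuousMap.norm_le _ (Real.exp_pos _).le).2 fun x => ?_
    have hτc : (τ x / c) ^ 2 ≤ 1 := by
      have := τ.norm_coe_le_norm x
      rw [Real.norm_eq_abs] at this
      rw [sq_le_one_iff_abs_le_one, abs_div, abs_of_pos hc, div_le_one hc]
      simp only [c]; linarith
    have hβτ : (β / c) ^ 2 ≤ (τ x / c) ^ 2 := by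
      rw [← neg_sq (τ x / c), ← neg_div]
      gcongr
      linarith [hτ x]
    have h1 : 0 ≤ 1 - ((τ x / c) ^ 2) ^ m := by
      linarith [pow_le_one₀ (n := m) (by positivity) hτc]
    rw [ContinuousMap.pow_apply, ContinuousMap.sub_apply, ContinuousMap.one_apply, hQ1,
      norm_pow, Real.norm_of_nonneg h1, ← mul_neg, Real.exp_nat_mul]
    gcongr
    calc 1 - ((τ x / c) ^ 2) ^ m ≤ 1 - ((β / c) ^ 2) ^ m := by gcongr
      _ ≤ _ := Real.one_sub_le_exp_neg _
  have hlim2 : Tendsto (fun m => (1 - (Q m).2) ^ N m) atTop (𝓝 1) := by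
    have hlow : Tendsto (fun m => 1 - N m * δ m) atTop (𝓝 1) := by
      simpa using hN0.const_sub 1
    refine tendsto_of_tendsto_of_tendsto_of_le_of_le hlow tendsto_const_nhds
      (fun m => ?_) (fun m => ?_)
    · have hq : ((1 / c) ^ 2) ^ m ≤ δ m := by simp only [δ]; gcongr
      have hq1 : ((1 / c) ^ 2) ^ m ≤ 1 := pow_le_one₀ (by positivity)
        (pow_le_one₀ (by positivity) ((div_le_one hc).2 (by linarith)))
      have := one_add_mul_le_pow (a := -(Q m).2) (by rw [hQ2]; linarith) (N m)
      have h3 : (N m : ℝ) * (Q m).2 ≤ N m * δ m := by rw [hQ2]; gcongr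
      simp only [sub_eq_add_neg] at *
      linarith
    · have hq1 : ((1 / c) ^ 2) ^ m ≤ 1 := pow_le_one₀ (by positivity)
        (pow_le_one₀ (by positivity) ((div_le_one hc).2 (by linarith)))
      have hq0 : 0 ≤ ((1 / c) ^ 2) ^ m := by positivity
      exact pow_le_one₀ (by rw [hQ2]; linarith) (by rw [hQ2]; linarith)
  have hlim : Tendsto (fun m => (1 - Q m) ^ N m - 1 + ((1 + δ m) ^ N m - 1) • V) atTop
      (𝓝 (-1, 0)) := by
    have h := ((hlim1.prodMk_nhds hlim2).sub_const (1 : C(X, ℝ) × ℝ)).add hlimV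
    have h0 : ((0, 1) - 1 + 0 : C(X, ℝ) × ℝ) = (-1, 0) := Prod.ext (by simp) (by simp)
    rwa [h0] at h
  exact (isClosed_closedPowerCone _).mem_of_tendsto hlim (Eventually.of_forall hmem)

theorem mk_zero_mem_closedPowerCone (τ : C(X, ℝ)) {β : ℝ} (hβ : 1 < β) (hτ : ∀ x, τ x ≤ -β)
    (hinj : Function.Injective τ) (f : C(X, ℝ)) : (f, (0 : ℝ)) ∈ closedPowerCone (τ, (1 : ℝ)) := by
  set E := closedPowerCone (τ, (1 : ℝ))
  have hneg := neg_one_mem_closedPowerCone τ hβ hτ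
  have hT : (τ, (1 : ℝ)) ∈ E := self_mem_closedPowerCone _
  have hclosed : IsClosed {g : C(X, ℝ) | (g, (0 : ℝ)) ∈ E} :=
    (isClosed_closedPowerCone _).preimage (by fun_prop)
  -- Multiplication by `(-1, 0)` supplies the negative scalars.
  have hsmul : ∀ (r : ℝ) (g : C(X, ℝ)), (g, (0 : ℝ)) ∈ E → (r • g, (0 : ℝ)) ∈ E := by
    intro r g hg
    rcases le_total 0 r with hr | hr
    · simpa using E.real_smul_mem hr hg
    · simpa using E.real_smul_mem (neg_nonneg.2 hr) (E.mul_mem hneg hg)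
  have hone : ((1 : C(X, ℝ)), (0 : ℝ)) ∈ E := by simpa using E.mul_mem hneg hneg
  have hadj : ((Algebra.adjoin ℝ {τ} : Subalgebra ℝ C(X, ℝ)) : Set C(X, ℝ)) ⊆
      {g : C(X, ℝ) | (g, (0 : ℝ)) ∈ E} := by
    intro g hg
    induction hg using Algebra.adjoin_induction with
    | mem x hx =>
      rw [Set.mem_singleton_iff] at hx
      subst hx
      simpa using E.mul_mem hone hT
    | algebraMap r => simpa [Algebra.algebraMap_eq_smul_one] using hsmul r 1 hone
    | add x y _ _ hx hy => simpa using E.add_mem hx hy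
    | mul x y _ _ hx hy => simpa using E.mul_mem hx hy
  have htop := ContinuousMap.subalgebra_topologicalClosure_eq_top_of_separatesPoints
    (Algebra.adjoin ℝ {τ}) (fun x y hxy =>
      ⟨τ, ⟨τ, Algebra.subset_adjoin rfl, rfl⟩, fun h => hxy (hinj h)⟩)
  have hf : f ∈ (Algebra.adjoin ℝ {τ}).topologicalClosure := htop ▸ Algebra.mem_top
  exact closure_minimal hadj hclosed hf

theorem fst_mem_smul_convexHull_of_mem_powerCone (τ : C(X, ℝ)) {z : C(X, ℝ) × ℝ}
    (hz : z ∈ powerCone (τ, (1 : ℝ))) :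
    0 ≤ z.2 ∧ z.1 ∈ z.2 • convexHull ℝ (Set.range fun n : ℕ => τ ^ n) := by
  have hconv := convex_convexHull ℝ (Set.range fun n : ℕ => τ ^ n)
  refine powerCone_induction
    (p := fun z => 0 ≤ z.2 ∧ z.1 ∈ z.2 • convexHull ℝ (Set.range fun n : ℕ => τ ^ n))
    (fun n => ?_) ?_ (fun z w hz hw => ?_) (fun c z hc hz => ?_) hz
  · simpa using subset_convexHull ℝ _ (Set.mem_range_self n)
  · exact ⟨le_rfl, 1, subset_convexHull ℝ _ ⟨0, pow_zero τ⟩, by simp⟩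
  · refine ⟨add_nonneg hz.1 hw.1, ?_⟩
    rw [Prod.snd_add, hconv.add_smul hz.1 hw.1]
    exact Set.add_mem_add hz.2 hw.2
  · refine ⟨mul_nonneg hc hz.1, ?_⟩
    obtain ⟨g, hg, hgz⟩ := hz.2
    refine ⟨g, hg, ?_⟩
    rw [Prod.smul_fst, ← hgz]
    exact mul_smul c z.2 g

theorem dense_convexHull_powers (τ : C(X, ℝ)) (hτ : ∀ x, τ x < -1)
    (hinj : Function.Injective τ) : Dense (convexHull ℝ (Set.range fun n : ℕ => τ ^ n)) := by
  obtain ⟨β, hβ, hτβ⟩ : ∃ β : ℝ, 1 < β ∧ ∀ x, τ x ≤ -β := by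
    rcases isEmpty_or_nonempty X with hX | hX
    · exact ⟨2, one_lt_two, fun x => hX.elim x⟩
    · obtain ⟨x, -, hx⟩ := isCompact_univ.exists_isMaxOn Set.univ_nonempty τ.continuous.continuousOn
      exact ⟨-τ x, by linarith [hτ x], fun y => by simpa using hx (Set.mem_univ y)⟩
  set K := convexHull ℝ (Set.range fun n : ℕ => τ ^ n)
  intro f
  have hmem : (f - 1, (0 : ℝ)) ∈ closure
      (powerCone (τ, (1 : ℝ)) : Set (C(X, ℝ) × ℝ)) :=
    mk_zero_mem_closedPowerCone τ hβ hτβ hinj (f - 1)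
  have hopen : IsOpen {z : C(X, ℝ) × ℝ | z.2 < 1} := isOpen_lt continuous_snd continuous_const
  have hmem' := hopen.inter_closure ⟨(zero_lt_one : (0 : ℝ) < 1), hmem⟩
  have hcont : Continuous fun z : C(X, ℝ) × ℝ => z.1 + (1 - z.2) • (1 : C(X, ℝ)) := by fun_prop
  have := map_mem_closure (t := K) hcont hmem' ?_
  · simpa using this
  · rintro z ⟨hz1, hz⟩
    obtain ⟨h0, h⟩ := fst_mem_smul_convexHull_of_mem_powerCone τ hz
    have h1 : (0 : ℝ) ≤ 1 - z.2 := sub_nonneg.2 (le_of_lt hz1)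
    have := Set.add_mem_add h (Set.smul_mem_smul_set (a := 1 - z.2)
      (subset_convexHull ℝ (Set.range fun n : ℕ => τ ^ n) ⟨0, pow_zero τ⟩))
    rw [← (convex_convexHull ℝ _).add_smul h0 h1] at this
    simpa using this

end Compact

/-! ### Passage to subsets of the line -/

theorem dense_convexPowers_of_odd {S : Set ℝ} (hS : ∀ x ∈ S, x < -1) {k : ℕ} (hk : Odd k) :
    Dense (convexPowers S k) := by
  intro f
  rw [mem_closure_iff_nhds_basis (nhds_basis_uniformity'
    Metric.uniformity_basis_dist.compactConvergenceUniformity)]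
  rintro ⟨K, ε⟩ ⟨hK, hε⟩
  have : CompactSpace K := isCompact_iff_compactSpace.1 hK
  let ι : C(K, S) := ⟨Subtype.val, continuous_subtype_val⟩
  let res := (ContinuousMap.compRightAlgHom ℝ ℝ ι).toLinearMap
  let τ : C(K, ℝ) := ⟨fun x => (x : ℝ) ^ k, by fun_prop⟩
  have hdense := dense_convexHull_powers τ
    (fun x => (hk.strictMono_pow (hS x.1 x.1.2)).trans_eq hk.neg_one_pow)
    (fun x y h => Subtype.ext (Subtype.ext (hk.strictMono_pow.injective h)))
  have himage : res '' convexPowers S k = convexHull ℝ (Set.range fun n : ℕ => τ ^ n) := by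
    rw [convexPowers, LinearMap.image_convexHull, ← Set.range_comp]
    congr 2
    ext n x
    exact pow_mul _ _ _
  obtain ⟨g, hg, hfg⟩ := Metric.mem_closure_iff.1 (hdense (res f)) ε hε
  rw [← himage] at hg
  obtain ⟨p, hp, rfl⟩ := hg
  exact ⟨p, hp, fun x hx => (ContinuousMap.dist_apply_le_dist (⟨x, hx⟩ : K)).trans_lt hfg⟩

theorem not_dense_convexPowers_of_even {S : Set ℝ} (hS : S.Nonempty) {k : ℕ} (hk : Even k) :
    ¬ Dense (convexPowers S k) := by
  obtain ⟨x, hx⟩ := hS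
  intro hd
  have hclosed : IsClosed {f : C(S, ℝ) | 0 ≤ f ⟨x, hx⟩} :=
    isClosed_le continuous_const (continuous_eval_const _)
  have hconv : Convex ℝ {f : C(S, ℝ) | 0 ≤ f ⟨x, hx⟩} := by
    intro f hf g hg a b ha hb _
    exact add_nonneg (mul_nonneg ha hf) (mul_nonneg hb hg)
  have hsub : convexPowers S k ⊆ {f : C(S, ℝ) | 0 ≤ f ⟨x, hx⟩} := by
    refine convexHull_min ?_ hconv
    rintro _ ⟨n, rfl⟩
    exact (hk.mul_right n).pow_nonneg x
  have := closure_minimal hsub hclosed (hd (-1))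
  norm_num at this

/-- The topology of `C(X, ℝ)` is the compact-open one (uniform convergence on compact sets); for
`X = [a, b]`, which is compact, it is the topology of the supremum norm. -/
theorem mainTheorem11 (a b : ℝ) (hab : a < b) (hb : b < -1) (k : ℕ) (hk : 0 < k) :
    (Dense (convexPowers (Set.Ioo a (-1)) k) ↔ Odd k) ∧
      (Dense (convexPowers (Set.Icc a b) k) ↔ Odd k) := by
  refine ⟨⟨fun h => ?_, dense_convexPowers_of_odd fun x hx => hx.2⟩,
    ⟨fun h => ?_, dense_convexPowers_of_odd fun x hx => hx.2.trans_lt hb⟩⟩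
  · by_contra hk
    exact not_dense_convexPowers_of_even (Set.nonempty_Ioo.2 (hab.trans hb))
      (Nat.not_odd_iff_even.1 hk) h
  · by_contra hk
    exact not_dense_convexPowers_of_even (Set.nonempty_Icc.2 hab.le)
      (Nat.not_odd_iff_even.1 hk) h
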